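/- Let $F$ be a field of characteristic zero and let $H$ be a Hopf algebra over $F$. An $H$-module algebra is an associative, not necessarily unital, $F$-algebra $W$ that is an $H$-module with $h\cdot(ab)=(h_{(1)}\cdot a)(h_{(2)}\cdot b)$ for all $h\in H$, $a,b\in W$, where $\Delta(h)=h_{(1)}\otimes h_{(2)}$. For a set $X$ of variables, let $F^H\langle X\rangle$ be the tensor algebra without $1$ of the vector space $FX\otimes_F H$; write $x^h$ for $x\otimes h$. It is an $H$-module algebra via $h\cdot(x_{1}^{h_1}\cdots x_{k}^{h_k})=x_{1}^{h_{(1)}h_1}\cdots x_{k}^{h_{(k)}h_k}$. For an $H$-module algebra $W$, an element $f\in F^H\langle X\rangle$ is an $H$-identity of $W$ if $\phi(f)=0$ for every homomorphism of $H$-module algebras $\phi:F^H\langle X\rangle\to W$, i.e. if $f$ vanishes under every substitution of elements of $W$ for the variables. Let $id^H(W)$ be the set of $H$-identities of $W$ in the countable set of variables $X=\{x_1,x_2,\dots\}$. An element of $F^H\langle x_1,x_2,\dots\rangle$ is multilinear in a finite set $N$ of variables if it is a linear combination of monomials $y_{1}^{h_1}\cdots y_{n}^{h_n}$ with $h_i\in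 H$, where $y_1,\dots,y_n$ is an ordering of the elements of $N$ without repetition. It is alternating in a set $S\subseteq N$ if interchanging any two different variables of $S$ changes its sign. For an integer $t\ge 1$, $W$ satisfies the $t$-th Capelli identity if every multilinear polynomial that is alternating in a set of at least $t$ of its variables is an $H$-identity of $W$. Theorem. Let $t\ge 1$ and let $W$ be an $H$-module algebra which satisfies the $t$-th Capelli identity. Let $$\mathcal W=F^H\langle x_1,\dots,x_{t-1}\rangle/\bigl(id^H(W)\cap F^H\langle x_1,\dots,x_{t-1}\rangle\bigr)$$ be the relatively free $H$-module algebra of $W$ on $t-1$ generators. Then $id^H(\mathcal W)=id^H(W)$. -/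

import Mathlib

set_option linter.unusedSectionVars false

noncomputable section

namespace HopfPI

open TensorProduct

/-- The orbit map `h ↦ h • a` of an element `a` of an `H`-module, as an `F`-linear map. -/
def orbitMap (F H : Type*) [Field F] [Ring H] [Algebra F H] {W : Type*} [AddCommGroup W]
    [Module F W] [Module H W] [IsScalarTower F H W] (a : W) : H →ₗ[F] W :=
  (LinearMap.toSpanSingleton H W a).restrictScalars F

/-- An `H`-module algebra: a (not necessarily unital) associative `F`-algebra `W` which is an
`H`-module such that `h • (a * b) = ∑ (h₍₁₎ • a) * (h₍₂₎ • b)`, where `Δ h = ∑ h₍₁₎ ⊗ h₍₂₎`. -/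
class HModuleAlgebra (F H W : Type*) [Field F] [Ring H] [HopfAlgebra F H]
    [NonUnitalRing W] [Module F W] [IsScalarTower F W W] [SMulCommClass F W W]
    [Module H W] [IsScalarTower F H W] : Prop where
  smul_mul' : ∀ (h : H) (a b : W), h • (a * b) =
    LinearMap.mul' F W (TensorProduct.map (orbitMap F H a) (orbitMap F H b)
      (Coalgebra.comul (R := F) h))

section Free

variable (F H : Type*) [Field F] [Ring H] [HopfAlgebra F H] (X : Type*)

/-- The tensor algebra (with `1`) of `FX ⊗ H`. The space `FX ⊗ H` is realised as `X →₀ H`: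
the tensor `x ⊗ h` is `Finsupp.single x h`. -/
abbrev Tens : Type _ := TensorAlgebra F (X →₀ H)

/-- The generator `x ^ h`, that is, `x ⊗ h`. -/
def gen {X : Type*} (x : X) (h : H) : Tens F H X := TensorAlgebra.ι F (Finsupp.single x h)

/-- The tensor algebra without `1`: the (non-unital) subalgebra generated by `FX ⊗ H`. -/
def hpolySubalgebra : NonUnitalSubalgebra F (Tens F H X) :=
  NonUnitalAlgebra.adjoin F (Set.range (TensorAlgebra.ι F))

/-- The algebra `F^H⟨X⟩` of `H`-polynomials in the variables `X`. -/
abbrev HPoly : Type _ := ↥(hpolySubalgebra F H X)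

/-- The action `p ↦ (h ↦ h · p)` of `H` on the tensor algebra. It is the unique
homomorphism to the convolution algebra `Hom(H, T(FX ⊗ H))` with
`h · (x ⊗ g) = x ⊗ h g`; multiplicativity for the convolution product says precisely that
`h · (p q) = ∑ (h₍₁₎ · p) (h₍₂₎ · q)`. -/
def actHom : Tens F H X →ₐ[F] WithConv (H →ₗ[F] Tens F H X) :=
  TensorAlgebra.lift F
    { toFun := fun v => WithConv.toConv ((TensorAlgebra.ι F).comp (orbitMap F H v))
      map_add' := fun v w => by
        ext h
        simp [orbitMap]
      map_smul' := fun c v => by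
        ext h
        simp only [orbitMap, RingHom.id_apply, WithConv.ofConv_smul, LinearMap.smul_apply,
          LinearMap.comp_apply, LinearMap.coe_restrictScalars, LinearMap.toSpanSingleton_apply]
        rw [smul_comm, map_smul] }

variable {F H X}

/-- `act h p` is `h · p`. -/
def act (h : H) (p : Tens F H X) : Tens F H X := (actHom F H X p).ofConv h

theorem act_ι (h : H) (v : X →₀ H) :
    act h (TensorAlgebra.ι F v) = TensorAlgebra.ι F (h • v) := by
  simp [act, actHom, orbitMap]

theorem act_gen (h : H) (x : X) (g : H) : act h (gen F H x g) = gen F H x (h * g) := by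
  simp [gen, act_ι]

theorem act_add (h : H) (p q : Tens F H X) : act h (p + q) = act h p + act h q := by
  simp [act]

theorem act_zero (h : H) : act h (0 : Tens F H X) = 0 := by
  simp [act]

theorem act_smul (h : H) (c : F) (p : Tens F H X) : act h (c • p) = c • act h p := by
  simp [act]

theorem act_add_left (h k : H) (p : Tens F H X) : act (h + k) p = act h p + act k p := by
  simp [act]

theorem act_zero_left (p : Tens F H X) : act (0 : H) p = 0 := by
  simp [act]

theorem act_smul_left (c : F) (h : H) (p : Tens F H X) : act (c • h) p = c • act h p := by
  simp [act]

theorem act_mul (h : H) (p q : Tens F H X) :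
    act h (p * q) = LinearMap.mul' F (Tens F H X)
      (TensorProduct.map (actHom F H X p).ofConv (actHom F H X q).ofConv
        (Coalgebra.comul (R := F) h)) := by
  simp [act]

theorem act_mul_repr (h : H) {ι : Type*} (r : Coalgebra.Repr F h ι) (p q : Tens F H X) :
    act h (p * q) = ∑ i ∈ r.index, act (r.left i) p * act (r.right i) q := by
  simp only [act, map_mul]
  exact r.convMul_apply _ _

theorem act_mem (h : H) {p : Tens F H X} (hp : p ∈ hpolySubalgebra F H X) :
    act h p ∈ hpolySubalgebra F H X := by
  induction hp using NonUnitalAlgebra.adjoin_induction generalizing h with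
  | mem x hx =>
    obtain ⟨v, rfl⟩ := hx
    rw [act_ι]
    exact NonUnitalAlgebra.subset_adjoin F ⟨_, rfl⟩
  | add x y _ _ hx hy => rw [act_add]; exact add_mem (hx h) (hy h)
  | zero => rw [act_zero]; exact zero_mem _
  | mul x y _ _ hx hy =>
    rw [act_mul_repr h (Coalgebra.Repr.arbitrary F h)]
    exact sum_mem fun i _ => mul_mem (hx _) (hy _)
  | smul r x _ hx => rw [act_smul]; exact SMulMemClass.smul_mem r (hx h)

theorem one_act (p : Tens F H X) (hp : p ∈ hpolySubalgebra F H X) : act (1 : H) p = p := by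
  induction hp using NonUnitalAlgebra.adjoin_induction with
  | mem x hx =>
    obtain ⟨v, rfl⟩ := hx
    rw [act_ι, one_smul]
  | add x y _ _ hx hy => rw [act_add, hx, hy]
  | zero => rw [act_zero]
  | mul x y _ _ hx hy =>
    rw [act_mul, Bialgebra.comul_one]
    simp only [Algebra.TensorProduct.one_def, TensorProduct.map_tmul, LinearMap.mul'_apply]
    exact congrArg₂ (· * ·) hx hy
  | smul r x _ hx => rw [act_smul, hx]

theorem mul_act (h k : H) (p : Tens F H X) (hp : p ∈ hpolySubalgebra F H X) :
    act (h * k) p = act h (act k p) := by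
  induction hp using NonUnitalAlgebra.adjoin_induction generalizing h k with
  | mem x hx =>
    obtain ⟨v, rfl⟩ := hx
    rw [act_ι, act_ι, act_ι, mul_smul]
  | add x y _ _ hx hy => rw [act_add, act_add, act_add, hx, hy]
  | zero => simp only [act_zero]
  | mul x y _ _ hx hy =>
    set hr := Coalgebra.Repr.arbitrary F h
    set kr := Coalgebra.Repr.arbitrary F k
    have hsum : ∀ (s : Finset (H × H)) (f : H × H → Tens F H X),
        act h (∑ i ∈ s, f i) = ∑ i ∈ s, act h (f i) := fun s f => by simp [act]
    rw [act_mul_repr k kr, hsum, act_mul, Bialgebra.comul_mul, ← hr.eq, ← kr.eq,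
      Finset.sum_mul_sum, Finset.sum_comm]
    simp only [map_sum, Algebra.TensorProduct.tmul_mul_tmul, TensorProduct.map_tmul,
      LinearMap.mul'_apply, act_mul_repr h hr]
    refine Finset.sum_congr rfl fun i _ => Finset.sum_congr rfl fun j _ => ?_
    exact congrArg₂ (· * ·) (hx _ _) (hy _ _)
  | smul r x _ hx => simp only [act_smul, hx]


instance : SMul H (HPoly F H X) := ⟨fun h p => ⟨act h p.1, act_mem h p.2⟩⟩

theorem coe_smul (h : H) (p : HPoly F H X) :
    ((h • p : HPoly F H X) : Tens F H X) = act h (p : Tens F H X) := rfl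

instance : Module H (HPoly F H X) where
  one_smul p := Subtype.ext (one_act p.1 p.2)
  mul_smul h k p := Subtype.ext (mul_act h k p.1 p.2)
  smul_zero h := Subtype.ext (act_zero h)
  smul_add h p q := Subtype.ext (act_add h p.1 q.1)
  add_smul h k p := Subtype.ext (act_add_left h k p.1)
  zero_smul p := Subtype.ext (act_zero_left p.1)

instance : IsScalarTower F H (HPoly F H X) :=
  ⟨fun c h p => Subtype.ext (act_smul_left c h p.1)⟩

instance : HModuleAlgebra F H (HPoly F H X) where
  smul_mul' h p q := by
    apply Subtype.ext
    rw [coe_smul, NonUnitalSubalgebra.coe_mul, act_mul]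
    induction Coalgebra.comul (R := F) h with
    | zero => simp
    | tmul a b => rfl
    | add x y hx hy => simp only [map_add, hx, hy, NonUnitalSubalgebra.coe_add]

/-- An `H`-polynomial is multilinear in the (finite) set of variables `N` if it is a linear
combination of monomials `x₁ ^ h₁ ⋯ xₙ ^ hₙ` in which every variable of `N` occurs exactly
once and no other variable occurs. -/
def IsMultilinear (N : Finset X) (f : HPoly F H X) : Prop :=
  (f : Tens F H X) ∈ Submodule.span F
    {p : Tens F H X | ∃ l : List (X × H), ((l.map Prod.fst : List X) : Multiset X) = N.val ∧
      p = (l.map fun a => gen F H a.1 a.2).prod}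

/-- Renaming of variables, `x ^ h ↦ (e x) ^ h`. -/
def renameVars {Y : Type*} (e : X → Y) : Tens F H X →ₐ[F] Tens F H Y :=
  TensorAlgebra.lift F ((TensorAlgebra.ι F).comp (Finsupp.lmapDomain H F e))

/-- `f` is alternating in the set of variables `S`: interchanging two different variables of
`S` changes the sign of `f`. -/
def IsAlternating [DecidableEq X] (S : Finset X) (f : HPoly F H X) : Prop :=
  ∀ x ∈ S, ∀ y ∈ S, x ≠ y →
    renameVars (F := F) (H := H) (Equiv.swap x y) (f : Tens F H X) = -(f : Tens F H X)

end Free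

section Identities

variable (F H : Type*) [Field F] [Ring H] [HopfAlgebra F H] (X : Type*)
variable (W : Type*) [NonUnitalRing W] [Module F W] [IsScalarTower F W W] [SMulCommClass F W W]
  [Module H W] [IsScalarTower F H W] [HModuleAlgebra F H W]

/-- The `H`-identities of `W` in the variables `X`: the `H`-polynomials which lie in the kernel
of every homomorphism of `H`-module algebras `F^H⟨X⟩ → W`. -/
def identities : Submodule H (HPoly F H X) where
  carrier := {f | ∀ φ : HPoly F H X →ₙₐ[F] W, (∀ (h : H) p, φ (h • p) = h • φ p) → φ f = 0}
  add_mem' hf hg φ hφ := by rw [map_add, hf φ hφ, hg φ hφ, add_zero]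
  zero_mem' φ _ := map_zero φ
  smul_mem' h f hf φ hφ := by rw [hφ, hf φ hφ, smul_zero]

variable {F H X W} in
theorem mul_mem_identities_left (p : HPoly F H X) {f : HPoly F H X}
    (hf : f ∈ identities F H X W) : p * f ∈ identities F H X W := fun φ hφ => by
  rw [map_mul, hf φ hφ, mul_zero]

variable {F H X W} in
theorem mul_mem_identities_right {f : HPoly F H X} (hf : f ∈ identities F H X W)
    (p : HPoly F H X) : f * p ∈ identities F H X W := fun φ hφ => by
  rw [map_mul, hf φ hφ, zero_mul]

/-- `W` satisfies the `t`-th Capelli identity: every multilinear `H`-polynomial which is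
alternating in at least `t` of its variables is an `H`-identity of `W`. -/
def SatisfiesCapelli (t : ℕ) : Prop :=
  ∀ (N S : Finset ℕ) (f : HPoly F H ℕ), S ⊆ N → t ≤ S.card → IsMultilinear N f →
    IsAlternating S f → f ∈ identities F H ℕ W

/-- The relatively free `H`-module algebra of `W` on the set of generators `X`: the quotient of
`F^H⟨X⟩` by the ideal of those of its elements which are `H`-identities of `W`. -/
def RelFree : Type _ := HPoly F H X ⧸ identities F H X W

namespace RelFree

instance : AddCommGroup (RelFree F H X W) :=
  inferInstanceAs (AddCommGroup (HPoly F H X ⧸ identities F H X W))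

instance : Module H (RelFree F H X W) :=
  inferInstanceAs (Module H (HPoly F H X ⧸ identities F H X W))

instance : Module F (RelFree F H X W) :=
  inferInstanceAs (Module F (HPoly F H X ⧸ identities F H X W))

instance : IsScalarTower F H (RelFree F H X W) :=
  inferInstanceAs (IsScalarTower F H (HPoly F H X ⧸ identities F H X W))

/-- The class of an `H`-polynomial in the relatively free algebra. -/
def mk : HPoly F H X →ₗ[H] RelFree F H X W := (identities F H X W).mkQ

variable {F H X W}

theorem mk_surjective : Function.Surjective (mk F H X W) := Submodule.mkQ_surjective _

theorem mk_eq {p q : HPoly F H X} :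
    mk F H X W p = mk F H X W q ↔ p - q ∈ identities F H X W :=
  Submodule.Quotient.eq _

theorem mk_smulF (c : F) (p : HPoly F H X) : mk F H X W (c • p) = c • mk F H X W p := rfl

instance : Mul (RelFree F H X W) where
  mul := Quotient.map₂ (· * ·) fun a a' ha b b' hb => by
    replace ha := (Submodule.quotientRel_def _).1 ha
    replace hb := (Submodule.quotientRel_def _).1 hb
    refine (Submodule.quotientRel_def _).2 ?_
    have : a * b - a' * b' = (a - a') * b + a' * (b - b') := by
      rw [sub_mul, mul_sub]
      abel
    rw [this]
    exact add_mem (mul_mem_identities_right ha b) (mul_mem_identities_left a' hb)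

theorem mk_mul (p q : HPoly F H X) :
    mk F H X W (p * q) = mk F H X W p * mk F H X W q := rfl

instance : NonUnitalRing (RelFree F H X W) where
  left_distrib a b c := by
    obtain ⟨a, rfl⟩ := mk_surjective a
    obtain ⟨b, rfl⟩ := mk_surjective b
    obtain ⟨c, rfl⟩ := mk_surjective c
    simp only [← mk_mul, ← map_add, mul_add]
  right_distrib a b c := by
    obtain ⟨a, rfl⟩ := mk_surjective a
    obtain ⟨b, rfl⟩ := mk_surjective b
    obtain ⟨c, rfl⟩ := mk_surjective c
    simp only [← mk_mul, ← map_add, add_mul]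
  zero_mul a := by
    obtain ⟨a, rfl⟩ := mk_surjective a
    rw [← map_zero (mk F H X W), ← mk_mul, zero_mul]
  mul_zero a := by
    obtain ⟨a, rfl⟩ := mk_surjective a
    rw [← map_zero (mk F H X W), ← mk_mul, mul_zero]
  mul_assoc a b c := by
    obtain ⟨a, rfl⟩ := mk_surjective a
    obtain ⟨b, rfl⟩ := mk_surjective b
    obtain ⟨c, rfl⟩ := mk_surjective c
    simp only [← mk_mul, mul_assoc]

instance : IsScalarTower F (RelFree F H X W) (RelFree F H X W) where
  smul_assoc c a b := by
    obtain ⟨a, rfl⟩ := mk_surjective a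
    obtain ⟨b, rfl⟩ := mk_surjective b
    simp only [smul_eq_mul, ← mk_mul, ← mk_smulF, smul_mul_assoc]

instance : SMulCommClass F (RelFree F H X W) (RelFree F H X W) where
  smul_comm c a b := by
    obtain ⟨a, rfl⟩ := mk_surjective a
    obtain ⟨b, rfl⟩ := mk_surjective b
    simp only [smul_eq_mul, ← mk_mul, ← mk_smulF, mul_smul_comm]

instance : HModuleAlgebra F H (RelFree F H X W) where
  smul_mul' h a b := by
    obtain ⟨p, rfl⟩ := mk_surjective a
    obtain ⟨q, rfl⟩ := mk_surjective b
    rw [← mk_mul, ← map_smul, HModuleAlgebra.smul_mul' (F := F)]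
    induction Coalgebra.comul (R := F) h with
    | zero => simp
    | tmul a b =>
      simp only [TensorProduct.map_tmul, LinearMap.mul'_apply, mk_mul]
      rfl
    | add x y hx hy => simp only [map_add, hx, hy]

end RelFree

end Identities


end HopfPI

end

noncomputable section

namespace HopfPI

section GroupAlgebra

open Equiv Finset

variable (F : Type*) [Field F] {ι κ : Type*} [Fintype ι] [DecidableEq ι] [DecidableEq κ]

/-- The permutation `σ` as an element of the group algebra. -/
abbrev perm (σ : Perm ι) : MonoidAlgebra F (Perm ι) := MonoidAlgebra.of F (Perm ι) σ

/-- The sum of all permutations preserving the colouring `c`. -/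
def symmetrizer (c : ι → κ) : MonoidAlgebra F (Perm ι) :=
  ∑ σ : Perm ι with ∀ i, c (σ i) = c i, perm F σ

/-- The signed sum of all permutations fixing the complement of `S`. -/
def antisymmetrizer (S : Finset ι) : MonoidAlgebra F (Perm ι) :=
  ∑ σ : Perm ι with ∀ i ∉ S, σ i = i, ((Perm.sign σ : ℤ) : F) • perm F σ

variable {F}

theorem perm_mul (σ τ : Perm ι) : perm F (σ * τ) = perm F σ * perm F τ := map_mul _ _ _

theorem antisymmetrizer_empty : antisymmetrizer F (∅ : Finset ι) = 1 := by
  have : (univ.filter fun σ : Perm ι => ∀ i ∉ (∅ : Finset ι), σ i = i) = {1} := by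
    ext σ
    simp [Perm.ext_iff]
  rw [antisymmetrizer, this]
  simp [MonoidAlgebra.one_def]

theorem antisymmetrizer_insert {k : ι} {S : Finset ι} (hk : k ∉ S) :
    antisymmetrizer F (insert k S) =
      antisymmetrizer F S * (1 - ∑ j ∈ S, perm F (swap k j)) := by
  have key : antisymmetrizer F (insert k S) =
      ∑ j ∈ insert k S, ∑ τ : Perm ι with ∀ i ∉ S, τ i = i,
        ((Perm.sign (τ * swap k j) : ℤ) : F) • perm F (τ * swap k j) := by
    rw [← Finset.sum_product', antisymmetrizer]
    refine Finset.sum_nbij' (fun σ => (σ⁻¹ k, σ * swap k (σ⁻¹ k))) (fun x => x.2 * swap k x.1)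
      ?_ ?_ ?_ ?_ ?_
    · intro σ hσ
      simp only [mem_filter, mem_univ, true_and, mem_product] at hσ ⊢
      refine ⟨?_, ?_⟩
      · by_contra h
        have := hσ _ h
        rw [show σ (σ⁻¹ k) = k from σ.apply_symm_apply k] at this
        exact h (this ▸ mem_insert_self _ _)
      · intro i hi
        rcases eq_or_ne i k with rfl | hik
        · simp
        rcases eq_or_ne i (σ⁻¹ k) with h | h
        · have h' : σ i = k := by rw [h]; simp
          have := hσ i (by simp [hik, hi])
          exact absurd (this.symm.trans h') hik
        · rw [Perm.mul_apply, swap_apply_of_ne_of_ne hik h]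
          exact hσ i (by simp [hik, hi])
    · rintro ⟨j, τ⟩ h
      simp only [mem_filter, mem_univ, true_and, mem_product] at h ⊢
      intro i hi
      have hij : i ≠ j := fun e => hi (e ▸ h.1)
      have hik : i ≠ k := fun e => hi (e ▸ mem_insert_self _ _)
      rw [Perm.mul_apply, swap_apply_of_ne_of_ne hik hij]
      exact h.2 i fun e => hi (mem_insert_of_mem e)
    · intro σ _
      simp [mul_assoc]
    · rintro ⟨j, τ⟩ h
      simp only [mem_filter, mem_univ, true_and, mem_product] at h
      have h2 : τ⁻¹ k = k := by rw [Perm.inv_eq_iff_eq]; exact (h.2 k hk).symm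
      have h3 : swap k j (τ⁻¹ k) = j := by rw [h2, swap_apply_left]
      rw [Prod.mk.injEq, mul_inv_rev, Perm.mul_apply, swap_inv, h3, mul_assoc, swap_mul_self]
      exact ⟨rfl, mul_one _⟩
    · intro σ _
      simp [mul_assoc]
  rw [key, Finset.sum_insert hk, mul_sub, mul_one, sub_eq_add_neg, mul_sum, ← sum_neg_distrib]
  congr 1
  · simp [antisymmetrizer, swap_self, ← Perm.one_def]
  · refine sum_congr rfl fun j hj => ?_
    have hkj : k ≠ j := fun e => hk (e ▸ hj)
    rw [antisymmetrizer, sum_mul, ← sum_neg_distrib]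
    refine sum_congr rfl fun τ _ => ?_
    rw [perm_mul, Perm.sign_mul, Perm.sign_swap hkj, smul_mul_assoc]
    simp

theorem antisymmetrizer_commute {S : Finset ι} {σ : Perm ι} (hσ : ∀ i ∈ S, σ i = i) :
    perm F σ * antisymmetrizer F S = antisymmetrizer F S * perm F σ := by
  rw [antisymmetrizer, mul_sum, sum_mul]
  refine sum_congr rfl fun τ hτ => ?_
  have h : Perm.Disjoint σ τ := fun i => by
    by_cases hi : i ∈ S
    · exact Or.inl (hσ i hi)
    · exact Or.inr ((mem_filter.1 hτ).2 i hi)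
  rw [mul_smul_comm, smul_mul_assoc, ← perm_mul, ← perm_mul, h.commute.eq]

theorem perm_mul_antisymmetrizer {S : Finset ι} {σ : Perm ι} (hσ : ∀ i ∉ S, σ i = i) :
    perm F σ * antisymmetrizer F S = ((Perm.sign σ : ℤ) : F) • antisymmetrizer F S := by
  rw [antisymmetrizer, mul_sum, smul_sum]
  refine Finset.sum_nbij' (fun τ => σ * τ) (fun τ => σ⁻¹ * τ) ?_ ?_ ?_ ?_ ?_
  · intro τ hτ
    simp only [mem_filter, mem_univ, true_and] at hτ ⊢
    intro i hi
    rw [Perm.mul_apply, hτ i hi, hσ i hi]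
  · intro τ hτ
    simp only [mem_filter, mem_univ, true_and] at hτ ⊢
    intro i hi
    rw [Perm.mul_apply, hτ i hi, Perm.inv_eq_iff_eq, hσ i hi]
  · simp
  · simp
  · intro τ _
    rw [mul_smul_comm, ← perm_mul, smul_smul, Perm.sign_mul]
    congr 1
    rcases Int.units_eq_one_or (Perm.sign σ) with h | h <;> simp [h]

theorem perm_mul_symmetrizer (c : ι → κ) (σ : Perm ι) :
    symmetrizer F c * perm F σ = perm F σ * symmetrizer F fun i => c (σ i) := by
  rw [symmetrizer, symmetrizer, mul_sum, sum_mul]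
  refine Finset.sum_nbij' (fun τ => σ⁻¹ * τ * σ) (fun τ => σ * τ * σ⁻¹) ?_ ?_ ?_ ?_ ?_
  · intro τ hτ
    simp only [mem_filter, mem_univ, true_and] at hτ ⊢
    intro i
    simp [hτ]
  · intro τ hτ
    simp only [mem_filter, mem_univ, true_and] at hτ ⊢
    intro i
    have := hτ (σ⁻¹ i)
    simpa using this
  · simp [mul_assoc]
  · simp [mul_assoc]
  · intro τ _
    simp only [← perm_mul, mul_assoc, mul_inv_cancel_left]

theorem symmetrizer_absorb_left {c : ι → κ} {σ : Perm ι} (hσ : ∀ i, c (σ i) = c i) :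
    perm F σ * symmetrizer F c = symmetrizer F c := by
  rw [symmetrizer, mul_sum]
  refine Finset.sum_nbij' (fun τ => σ * τ) (fun τ => σ⁻¹ * τ) ?_ ?_ ?_ ?_ ?_
  · intro τ hτ
    simp only [mem_filter, mem_univ, true_and] at hτ ⊢
    intro i
    simp [hσ, hτ]
  · intro τ hτ
    simp only [mem_filter, mem_univ, true_and] at hτ ⊢
    intro i
    rw [← hσ, Perm.mul_apply, show σ (σ⁻¹ (τ i)) = τ i from σ.apply_symm_apply _, hτ]
  · simp
  · simp
  · intro τ _
    rw [perm_mul]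

theorem symmetrizer_absorb_right {c : ι → κ} {σ : Perm ι} (hσ : ∀ i, c (σ i) = c i) :
    symmetrizer F c * perm F σ = symmetrizer F c := by
  rw [perm_mul_symmetrizer]
  simp only [hσ]
  exact symmetrizer_absorb_left hσ

/-- Decomposition of the symmetrizer into cosets of the stabilizer of `k`. -/
theorem symmetrizer_eq_sum_swap (c : ι → κ) (k : ι) :
    symmetrizer F c = (∑ a with c a = c k, perm F (swap a k)) *
      ∑ σ : Perm ι with (∀ i, c (σ i) = c i) ∧ σ k = k, perm F σ := by
  rw [sum_mul_sum, ← sum_product', symmetrizer]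
  refine Finset.sum_nbij' (fun σ => (σ k, swap (σ k) k * σ)) (fun x => swap x.1 k * x.2)
      ?_ ?_ ?_ ?_ ?_
  · intro σ hσ
    simp only [mem_filter, mem_univ, true_and, mem_product] at hσ ⊢
    refine ⟨hσ k, fun i => ?_, by simp⟩
    rw [Perm.mul_apply, swap_apply_def]
    split_ifs with h1 h2
    · rw [← hσ i, h1, hσ]
    · rw [← hσ i, h2, hσ]
    · exact hσ i
  · rintro ⟨a, σ⟩ h
    simp only [mem_filter, mem_univ, true_and, mem_product] at h ⊢
    intro i
    rw [Perm.mul_apply, swap_apply_def]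
    split_ifs with h1 h2
    · rw [← h.2.1 i, h1, h.1]
    · rw [← h.2.1 i, h2, h.1]
    · exact h.2.1 i
  · intro σ _
    simp
  · rintro ⟨a, σ⟩ h
    simp only [mem_filter, mem_univ, true_and, mem_product] at h
    simp [h.2.2]
  · intro σ _
    rw [← perm_mul]
    simp

section Module

variable [CharZero F] {M : Type*} [AddCommGroup M] [Module F M]
  [Module (MonoidAlgebra F (Perm ι)) M] [IsScalarTower F (MonoidAlgebra F (Perm ι)) M]

/-- If no colouring obtained by moving `k` to the colour `p` contributes, then
`symmetrizer c • m` satisfies a linear relation. -/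
theorem sum_swap_smul_eq_zero {c : ι → κ} {k : ι} {p : κ} (hp : p ≠ c k) {m : M}
    (h : ∀ σ : Perm ι,
      symmetrizer F (fun i => Function.update c k p (σ i)) • m = 0) :
    symmetrizer F c • m +
      ∑ a with c a = p, perm F (swap a k) • symmetrizer F c • m = 0 := by
  set c' := Function.update c k p with hc'
  have h0 : (symmetrizer F c' * symmetrizer F c) • m = 0 := by
    nth_rewrite 2 [symmetrizer]
    rw [mul_sum, sum_smul]
    refine sum_eq_zero fun σ _ => ?_
    rw [perm_mul_symmetrizer, mul_smul, h, smul_zero]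
  rw [symmetrizer_eq_sum_swap c' k, mul_assoc] at h0
  have h1 : (∑ σ : Perm ι with (∀ i, c' (σ i) = c' i) ∧ σ k = k, perm F σ) * symmetrizer F c =
      ((#{σ : Perm ι | (∀ i, c' (σ i) = c' i) ∧ σ k = k} : ℕ) : F) • symmetrizer F c := by
    rw [sum_mul, Nat.cast_smul_eq_nsmul, ← sum_const]
    refine sum_congr rfl fun σ hσ => symmetrizer_absorb_left fun i => ?_
    have hσ := (mem_filter.1 hσ).2
    rcases eq_or_ne i k with rfl | hi
    · rw [hσ.2]
    · have h2 : σ i ≠ k := fun e => hi (σ.injective (e.trans hσ.2.symm))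
      have := hσ.1 i
      rwa [hc', Function.update_of_ne h2, Function.update_of_ne hi] at this
  rw [h1, mul_smul_comm, smul_assoc] at h0
  have hne : ((#{σ : Perm ι | (∀ i, c' (σ i) = c' i) ∧ σ k = k} : ℕ) : F) ≠ 0 := by
    rw [Nat.cast_ne_zero, ← Nat.pos_iff_ne_zero, card_pos]
    exact ⟨1, by simp⟩
  have h3 := (smul_eq_zero_iff_right hne).1 h0
  have hset : (univ.filter fun a => c' a = c' k) = insert k (univ.filter fun a => c a = p) := by
    ext a
    rcases eq_or_ne a k with rfl | ha
    · simp
    · simp [hc', ha]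
  rw [hset, sum_insert (by simpa using hp.symm), mul_smul, add_smul, sum_smul] at h3
  rwa [swap_self, ← Perm.one_def, perm, map_one, one_smul] at h3

/-- The antisymmetrizer of representatives of some colour classes acts injectively on vectors
which behave like highest weight vectors. -/
theorem eq_zero_of_antisymmetrizer_smul {c : ι → κ} {u : M}
    (hu : ∀ σ : Perm ι, (∀ i, c (σ i) = c i) → perm F σ • u = u)
    (hw : ∀ k j, c k ≠ c j → #{a | c a = c j} ≤ #{a | c a = c k} →
      u + ∑ a with c a = c k, perm F (swap a j) • u = 0)
    (T : Finset ι) (hT : Set.InjOn c T)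
    (h : symmetrizer F c • antisymmetrizer F T • u = 0) : u = 0 := by
  induction T using Finset.induction_on_max_value (fun k => #{a | c a = c k}) with
  | empty =>
    rw [antisymmetrizer_empty, one_smul, symmetrizer, sum_smul,
      sum_congr rfl fun σ hσ => hu σ (mem_filter.1 hσ).2, sum_const,
      ← Nat.cast_smul_eq_nsmul F] at h
    refine (smul_eq_zero_iff_right ?_).1 h
    rw [Nat.cast_ne_zero, ← Nat.pos_iff_ne_zero, card_pos]
    exact ⟨1, by simp⟩
  | insert k S hk hmax ih =>
    refine ih (hT.mono (by simp)) ?_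
    have hcS : ∀ j ∈ S, c j ≠ c k := fun j hj e =>
      hk ((hT (by simp [hj]) (by simp) e) ▸ hj)
    set v := symmetrizer F c • antisymmetrizer F S • u with hv
    have hj : ∀ j ∈ S, ((#{a | c a = c k} : ℕ) : F) •
        (symmetrizer F c • antisymmetrizer F S • perm F (swap k j) • u) = -v := by
      intro j hj
      have h1 := hw k j (hcS j hj).symm (hmax j hj)
      have h2 : antisymmetrizer F S • (∑ a with c a = c k, perm F (swap a j) • u) =
          -(antisymmetrizer F S • u) := by
        rw [← smul_neg, ← eq_neg_of_add_eq_zero_right h1]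
      rw [hv, ← smul_neg, ← h2, smul_sum, smul_sum, Nat.cast_smul_eq_nsmul, ← sum_const]
      refine sum_congr rfl fun a ha => ?_
      have ha : c a = c k := (mem_filter.1 ha).2
      have hstab : ∀ i, c (swap a k i) = c i := fun i => by
        rw [swap_apply_def]
        split_ifs with e1 e2
        · rw [e1, ha]
        · rw [e2, ha]
        · rfl
      have hfix : ∀ i ∈ S, swap a k i = i := fun i hi =>
        swap_apply_of_ne_of_ne (fun e => hcS i hi (e ▸ ha)) fun e => hk (e ▸ hi)
      have hconj : swap a j = swap a k * swap k j * swap a k := by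
        rw [swap_comm a k, swap_comm k j]
        have hjk : j ≠ k := fun e => hk (e ▸ hj)
        have hja : j ≠ a := fun e => hcS j hj (e ▸ ha)
        exact (swap_mul_swap_mul_swap hjk hja).symm
      rw [hconj, perm_mul, perm_mul, mul_smul, mul_smul, hu _ hstab,
        ← mul_smul (antisymmetrizer F S) (perm F (swap a k)), ← antisymmetrizer_commute hfix,
        mul_smul (perm F (swap a k)), ← mul_smul (symmetrizer F c) (perm F (swap a k)),
        symmetrizer_absorb_right hstab]
    rw [antisymmetrizer_insert hk, mul_smul, sub_smul, one_smul, smul_sub, smul_sub, ← hv,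
      sum_smul, smul_sum, smul_sum] at h
    have h' := congrArg (fun x => ((#{a | c a = c k} : ℕ) : F) • x) h
    simp only [smul_sub, smul_sum, smul_zero] at h'
    rw [sum_congr rfl hj, sum_const, smul_neg, sub_neg_eq_add, ← Nat.cast_smul_eq_nsmul F,
      ← add_smul, ← Nat.cast_add] at h'
    refine (smul_eq_zero_iff_right ?_).1 h'
    rw [Nat.cast_ne_zero, ← Nat.pos_iff_ne_zero]
    exact Nat.add_pos_left (card_pos.2 ⟨k, by simp⟩) _

end Module

theorem sum_sq_card_lt (c : ι → ι) {k : ι} {p : ι} (hp : p ≠ c k)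
    (h : #{a | c a = c k} ≤ #{a | c a = p}) :
    ∑ r, #{a | c a = r} ^ 2 < ∑ r, #{a | Function.update c k p a = r} ^ 2 := by
  have hkc : k ∈ univ.filter fun a => c a = c k := by simp
  have h1 : (univ.filter fun a => Function.update c k p a = p) =
      insert k (univ.filter fun a => c a = p) := by
    ext a
    rcases eq_or_ne a k with rfl | ha
    · simp
    · simp [ha]
  have h2 : (univ.filter fun a => Function.update c k p a = c k) =
      (univ.filter fun a => c a = c k).erase k := by
    ext a
    rcases eq_or_ne a k with rfl | ha
    · simp [hp]
    · simp [ha]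
  have h3 : ∀ r ∈ (univ.erase p).erase (c k), #{a | c a = r} ^ 2 =
      #{a | Function.update c k p a = r} ^ 2 := by
    intro r hr
    have hr1 : r ≠ c k := (mem_erase.1 hr).1
    have hr2 : r ≠ p := (mem_erase.1 (mem_erase.1 hr).2).1
    congr 2
    ext a
    rcases eq_or_ne a k with rfl | ha
    · simp [hr1.symm, hr2.symm]
    · simp [ha]
  have hck : c k ∈ univ.erase p := mem_erase.2 ⟨hp.symm, mem_univ _⟩
  rw [← add_sum_erase _ _ (mem_univ p), ← add_sum_erase _ _ hck,
    ← add_sum_erase univ (fun r => #{a | Function.update c k p a = r} ^ 2) (mem_univ p),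
    ← add_sum_erase _ (fun r => #{a | Function.update c k p a = r} ^ 2) hck,
    sum_congr rfl h3, h1, h2, card_insert_of_notMem (by simpa using hp.symm),
    card_erase_of_mem hkc]
  obtain ⟨x, hx⟩ : ∃ x, #{a | c a = c k} = x + 1 :=
    ⟨_, (Nat.succ_pred_eq_of_pos (card_pos.2 ⟨k, hkc⟩)).symm⟩
  rw [hx] at h ⊢
  simp only [Nat.add_sub_cancel]
  nlinarith

/-- In characteristic zero, the antisymmetrizers of sets with at least `t` elements and the
symmetrizers of the colourings with fewer than `t` colours generate the group algebra. -/
theorem one_mem_of_symmetrizer_mem [CharZero F] {t : ℕ} (ht : 1 ≤ t)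
    (L : Submodule (MonoidAlgebra F (Perm ι)) (MonoidAlgebra F (Perm ι)))
    (halt : ∀ S : Finset ι, t ≤ #S → ∀ a, antisymmetrizer F S * a ∈ L)
    (hsymm : ∀ c : ι → Fin (t - 1), symmetrizer F c ∈ L) : 1 ∈ L := by
  classical
  set m : MonoidAlgebra F (Perm ι) ⧸ L := L.mkQ 1 with hm
  have hmk : ∀ a, a • m = L.mkQ a := fun a => by rw [hm, ← map_smul, smul_eq_mul, mul_one]
  have hmem : ∀ a, a • m = 0 ↔ a ∈ L := fun a => by
    rw [hmk, Submodule.mkQ_apply, Submodule.Quotient.mk_eq_zero]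
  have hcol : ∀ c : ι → ι, symmetrizer F c • m = 0 := by
    by_contra! hex
    obtain ⟨c₀, hc₀⟩ := hex
    obtain ⟨c, hc, hmax⟩ := Finset.exists_max_image
      (univ.filter fun c : ι → ι => symmetrizer F c • m ≠ 0)
      (fun c => ∑ r, #{a | c a = r} ^ 2) ⟨c₀, by simpa using hc₀⟩
    replace hc := (mem_filter.1 hc).2
    have hgt : ∀ c' : ι → ι, ∑ r, #{a | c a = r} ^ 2 < ∑ r, #{a | c' a = r} ^ 2 →
        symmetrizer F c' • m = 0 := fun c' h => by
      by_contra h'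
      exact absurd (hmax c' (by simpa using h')) (not_le.2 h)
    rcases lt_or_ge #(univ.image c) t with hlt | hge
    · obtain ⟨e⟩ : Nonempty (univ.image c ↪ Fin (t - 1)) := by
        refine Function.Embedding.nonempty_of_card_le ?_
        rw [Fintype.card_coe, Fintype.card_fin]
        omega
      have he := hsymm fun i => e ⟨c i, mem_image_of_mem c (mem_univ i)⟩
      simp only [symmetrizer, e.injective.eq_iff, Subtype.mk.injEq] at he
      exact hc ((hmem _).2 he)
    · obtain ⟨T, -, hinj, hT⟩ := Finset.exists_subset_injOn_image_eq_of_surjOn (f := c)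
        Set.univ (univ.image c) (by intro; simp)
      refine hc (eq_zero_of_antisymmetrizer_smul (F := F) (c := c) (fun σ hσ => ?_)
        (fun k j hkj hcard => ?_) T hinj ?_)
      · rw [← mul_smul, symmetrizer_absorb_left hσ]
      · refine sum_swap_smul_eq_zero hkj fun σ => hgt _ ?_
        refine (sum_sq_card_lt c hkj hcard).trans_eq (sum_congr rfl fun r _ => ?_)
        congr 1
        refine card_nbij' (fun a => σ⁻¹ a) (fun a => σ a) ?_ ?_ ?_ ?_ <;> intro a <;> simp
      · have : #T = #(univ.image c) := by rw [← hT, card_image_of_injOn hinj]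
        rw [← mul_smul (antisymmetrizer F T), hmk, Submodule.mkQ_apply]
        have := halt T (by omega) (symmetrizer F c)
        rw [(Submodule.Quotient.mk_eq_zero L).2 this]
        rw [smul_zero]
  have h1 : symmetrizer F (id : ι → ι) = 1 := by
    have : (univ.filter fun σ : Perm ι => ∀ i, id (σ i) = id i) = {1} := by
      ext σ
      simp [Perm.ext_iff]
    rw [symmetrizer, this]
    simp [MonoidAlgebra.one_def]
  exact (hmem 1).1 (h1 ▸ hcol id)

end GroupAlgebra

section Substitution

variable {F H : Type*} [Field F] [Ring H] [HopfAlgebra F H] {X Y : Type*}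

/-- The substitution `x ^ h ↦ h · s x`. -/
def subst (s : X → HPoly F H Y) : Tens F H X →ₐ[F] Tens F H Y :=
  TensorAlgebra.lift F (Finsupp.lsum F fun x => (actHom F H Y (s x)).ofConv)

theorem subst_gen (s : X → HPoly F H Y) (x : X) (h : H) :
    subst s (gen F H x h) = act h (s x : Tens F H Y) := by
  simp [subst, gen, act]

theorem gen_mem (x : X) (h : H) : gen F H x h ∈ hpolySubalgebra F H X :=
  NonUnitalAlgebra.subset_adjoin F ⟨_, rfl⟩

theorem tens_ext {A : Type*} [Semiring A] [Algebra F A] {φ ψ : Tens F H X →ₐ[F] A}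
    (h : ∀ x k, φ (gen F H x k) = ψ (gen F H x k)) : φ = ψ := by
  apply TensorAlgebra.hom_ext
  apply Finsupp.lhom_ext
  exact h

theorem hpoly_induction {P : ∀ p : Tens F H X, p ∈ hpolySubalgebra F H X → Prop}
    (hgen : ∀ x h, P (gen F H x h) (gen_mem x h)) (hzero : P 0 (zero_mem _))
    (hadd : ∀ p q hp hq, P p hp → P q hq → P (p + q) (add_mem hp hq))
    (hmul : ∀ p q hp hq, P p hp → P q hq → P (p * q) (mul_mem hp hq))
    (hsmul : ∀ (c : F) p hp, P p hp → P (c • p) (SMulMemClass.smul_mem c hp))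
    {p : Tens F H X} (hp : p ∈ hpolySubalgebra F H X) : P p hp := by
  induction hp using NonUnitalAlgebra.adjoin_induction with
  | mem x hx =>
    obtain ⟨v, rfl⟩ := hx
    have h : ∃ h, P (TensorAlgebra.ι F v) h := by
      induction v using Finsupp.induction_linear with
      | zero => rw [map_zero]; exact ⟨_, hzero⟩
      | add v w hv hw =>
        rw [map_add]
        exact ⟨_, hadd _ _ _ _
          hv.2 hw.2⟩
      | single x h => exact ⟨_, hgen x h⟩
    exact h.2
  | add x y hx' hy' hx hy => exact hadd _ _ hx' hy' hx hy
  | zero => exact hzero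
  | mul x y hx' hy' hx hy => exact hmul _ _ hx' hy' hx hy
  | smul r x hx' hx => exact hsmul _ _ hx' hx

theorem subst_mem (s : X → HPoly F H Y) {p : Tens F H X} (hp : p ∈ hpolySubalgebra F H X) :
    subst s p ∈ hpolySubalgebra F H Y := by
  induction hp using hpoly_induction with
  | hgen x h => rw [subst_gen]; exact act_mem h (s x).2
  | hzero => rw [map_zero]; exact zero_mem _
  | hadd p q _ _ hp hq => rw [map_add]; exact add_mem hp hq
  | hmul p q _ _ hp hq => rw [map_mul]; exact mul_mem hp hq
  | hsmul c p _ hp => rw [map_smul]; exact SMulMemClass.smul_mem c hp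

theorem subst_act (s : X → HPoly F H Y) (h : H) {p : Tens F H X}
    (hp : p ∈ hpolySubalgebra F H X) : subst s (act h p) = act h (subst s p) := by
  induction hp using hpoly_induction generalizing h with
  | hgen x k => rw [act_gen, subst_gen, subst_gen, mul_act _ _ _ (s x).2]
  | hzero => simp only [act_zero, map_zero]
  | hadd p q _ _ hp hq => simp only [act_add, map_add, hp, hq]
  | hmul p q _ _ hp hq =>
    have hr := Coalgebra.Repr.arbitrary F h
    simp only [map_mul, act_mul_repr h hr, map_sum, hp, hq]
  | hsmul c p _ hp => simp only [act_smul, map_smul, hp]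

/-- Substitution as a homomorphism of algebras without `1`. -/
def substHom (s : X → HPoly F H Y) : HPoly F H X →ₙₐ[F] HPoly F H Y where
  toFun p := ⟨subst s p, subst_mem s p.2⟩
  map_smul' c p := Subtype.ext (map_smul (subst s) c p.1)
  map_zero' := Subtype.ext (map_zero (subst s))
  map_add' p q := Subtype.ext (map_add (subst s) p.1 q.1)
  map_mul' p q := Subtype.ext (map_mul (subst s) p.1 q.1)

theorem substHom_smul (s : X → HPoly F H Y) (h : H) (p : HPoly F H X) :
    substHom s (h • p) = h • substHom s p :=
  Subtype.ext (subst_act s h p.2)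

theorem renameVars_gen (e : X → Y) (x : X) (h : H) :
    renameVars e (gen F H x h) = gen F H (e x) h := by
  simp [renameVars, gen]

/-- The variable `x`. -/
def var (x : X) : HPoly F H X := ⟨gen F H x 1, gen_mem x 1⟩

theorem renameVars_eq_subst (e : X → Y) :
    renameVars (F := F) (H := H) e = subst fun x => var (e x) := by
  refine tens_ext fun x h => ?_
  rw [renameVars_gen, subst_gen, var, act_gen, mul_one]

theorem renameVars_renameVars {Z : Type*} (e : Y → Z) (e' : X → Y) (p : Tens F H X) :
    renameVars e (renameVars e' p) = renameVars (e ∘ e') p := by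
  have : (renameVars (F := F) (H := H) e).comp (renameVars e') = renameVars (e ∘ e') :=
    tens_ext fun x h => by simp only [AlgHom.comp_apply, renameVars_gen, Function.comp_apply]
  exact congrArg (fun φ => φ p) this

theorem renameVars_id (p : Tens F H X) : renameVars id p = p := by
  have : renameVars (F := F) (H := H) (id : X → X) = AlgHom.id F _ :=
    tens_ext fun x h => by simp only [renameVars_gen, AlgHom.id_apply, id]
  rw [this, AlgHom.id_apply]

end Substitution

section IdentitySubspace

variable {F H : Type*} [Field F] [Ring H] [HopfAlgebra F H] {X Y : Type*}
variable (W : Type*) [NonUnitalRing W] [Module F W] [IsScalarTower F W W] [SMulCommClass F W W]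
  [Module H W] [IsScalarTower F H W] [HModuleAlgebra F H W]

variable (F H X) in
/-- The identities of `W`, as a subspace of the tensor algebra. -/
def idSubspace : Submodule F (Tens F H X) where
  carrier := {p | ∃ hp : p ∈ hpolySubalgebra F H X, (⟨p, hp⟩ : HPoly F H X) ∈ identities F H X W}
  add_mem' := fun ⟨hp, hp'⟩ ⟨hq, hq'⟩ => ⟨add_mem hp hq, add_mem hp' hq'⟩
  zero_mem' := ⟨zero_mem _, zero_mem _⟩
  smul_mem' c _ := fun ⟨hp, hp'⟩ => ⟨SMulMemClass.smul_mem c hp, fun φ hφ =>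
    (map_smul φ c _).trans (by rw [hp' φ hφ, smul_zero])⟩

variable {W}

theorem mem_idSubspace {f : HPoly F H X} :
    (f : Tens F H X) ∈ idSubspace F H X W ↔ f ∈ identities F H X W :=
  ⟨fun h => h.2, fun h => ⟨f.2, h⟩⟩

theorem substHom_mem_identities (s : X → HPoly F H Y) {f : HPoly F H X}
    (hf : f ∈ identities F H X W) : substHom s f ∈ identities F H Y W := fun φ hφ =>
  hf (φ.comp (substHom s)) fun h p => by
    rw [NonUnitalAlgHom.comp_apply, substHom_smul, hφ, NonUnitalAlgHom.comp_apply]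

theorem subst_mem_idSubspace (s : X → HPoly F H Y) {p : Tens F H X}
    (hp : p ∈ idSubspace F H X W) : subst s p ∈ idSubspace F H Y W :=
  ⟨subst_mem s hp.1, substHom_mem_identities s hp.2⟩

theorem renameVars_mem_idSubspace (e : X → Y) {p : Tens F H X}
    (hp : p ∈ idSubspace F H X W) : renameVars e p ∈ idSubspace F H Y W := by
  rw [renameVars_eq_subst]
  exact subst_mem_idSubspace _ hp

/-- The projection to the relatively free algebra as a homomorphism of algebras. -/
def relFreeMk : HPoly F H X →ₙₐ[F] RelFree F H X W where
  toFun := RelFree.mk F H X W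
  map_smul' c p := RelFree.mk_smulF c p
  map_zero' := map_zero _
  map_add' := map_add _
  map_mul' := RelFree.mk_mul

theorem subst_mem_of_mem_identities_relFree {f : HPoly F H X}
    (hf : f ∈ identities F H X (RelFree F H Y W)) (s : X → HPoly F H Y) :
    subst s f ∈ idSubspace F H Y W := by
  have h := hf (relFreeMk.comp (substHom s)) fun h p => by
    rw [NonUnitalAlgHom.comp_apply, substHom_smul]
    exact map_smul (RelFree.mk F H Y W) _ _
  have h' : RelFree.mk F H Y W (substHom s f) = RelFree.mk F H Y W 0 := h.trans (map_zero _).symm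
  rw [RelFree.mk_eq, sub_zero] at h'
  exact mem_idSubspace.2 h'

theorem identities_le_identities_relFree :
    identities F H X W ≤ identities F H X (RelFree F H Y W) := by
  intro f hf φ hφ
  choose s hs using fun x => RelFree.mk_surjective (F := F) (H := H) (W := W) (φ (var x))
  have key : ∀ p (hp : p ∈ hpolySubalgebra F H X),
      φ ⟨p, hp⟩ = RelFree.mk F H Y W (substHom s ⟨p, hp⟩) := by
    have : ∀ p ∈ hpolySubalgebra F H X, ∃ q : HPoly F H X, q.1 = p ∧
        φ q = RelFree.mk F H Y W (substHom s q) := by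
      intro p hp
      induction hp using hpoly_induction with
      | hgen x h =>
        refine ⟨h • var x, ?_, ?_⟩
        · rw [coe_smul, var, act_gen, mul_one]
        · rw [hφ, substHom_smul, map_smul, ← hs]
          congr 2
          refine Subtype.ext ?_
          change _ = subst s (gen F H x 1)
          rw [subst_gen, one_act _ (s x).2]
      | hzero => exact ⟨0, rfl, by simp only [map_zero]⟩
      | hadd p q _ _ hp hq =>
        obtain ⟨p, rfl, hp⟩ := hp
        obtain ⟨q, rfl, hq⟩ := hq
        exact ⟨p + q, rfl, by simp only [map_add, hp, hq]⟩
      | hmul p q _ _ hp hq =>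
        obtain ⟨p, rfl, hp⟩ := hp
        obtain ⟨q, rfl, hq⟩ := hq
        exact ⟨p * q, rfl, by simp only [map_mul, hp, hq, RelFree.mk_mul]⟩
      | hsmul c p _ hp =>
        obtain ⟨p, rfl, hp⟩ := hp
        exact ⟨c • p, rfl, by simp only [map_smul, hp, RelFree.mk_smulF]⟩
    intro p hp
    obtain ⟨q, rfl, hq⟩ := this p hp
    exact hq
  rw [key f.1 f.2, ← sub_zero (substHom s _), ← map_zero (RelFree.mk F H Y W), RelFree.mk_eq]
  simpa using substHom_mem_identities s hf

end IdentitySubspace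

section Linearization

open Finset

theorem sum_neg_one_pow_card_compl {F : Type*} [Field F] {n : ℕ} (r : Fin n → Fin n) :
    ∑ S : Finset (Fin n), (if ∀ i, r i ∈ S then (-1 : F) ^ #Sᶜ else 0) =
      if Function.Bijective r then 1 else 0 := by
  have h1 : ∀ S : Finset (Fin n), (if ∀ i, r i ∈ S then (-1 : F) ^ #Sᶜ else 0) =
      (∏ _j ∈ S, 1) * ∏ j ∈ univ \ S, (if ∃ i, r i = j then (0 : F) else -1) := by
    intro S
    rw [prod_const_one, one_mul]
    split_ifs with h
    · rw [← compl_eq_univ_sdiff, ← prod_const]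
      refine prod_congr rfl fun j hj => ?_
      rw [if_neg]
      rintro ⟨i, rfl⟩
      exact (mem_compl.1 hj) (h i)
    · push Not at h
      obtain ⟨i, hi⟩ := h
      exact (prod_eq_zero (M₀ := F) (i := r i) (by simpa using hi) (if_pos ⟨i, rfl⟩)).symm
  rw [sum_congr rfl fun S _ => h1 S, ← powerset_univ, ← prod_add]
  split_ifs with h
  · exact prod_eq_one fun j _ => by rw [if_pos (h.2 j), add_zero]
  · have : ¬ Function.Surjective r := fun hs => h ⟨Finite.injective_iff_surjective.2 hs, hs⟩
    rw [Function.Surjective] at this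
    push Not at this
    obtain ⟨j, hj⟩ := this
    exact prod_eq_zero (mem_univ j) (by rw [if_neg (by simpa using hj)]; norm_num)

variable {F H : Type*} [Field F] [Ring H] [HopfAlgebra F H] {X Y : Type*} {n : ℕ}

/-- The monomial `w₁ ^ h₁ ⋯ wₙ ^ hₙ`. -/
def mono (w : Fin n → X) (h : Fin n → H) : Tens F H X :=
  TensorAlgebra.tprod F (X →₀ H) n fun i => Finsupp.single (w i) (h i)

theorem mono_eq_prod (w : Fin n → X) (h : Fin n → H) :
    mono w h = (List.ofFn fun i => gen F H (w i) (h i)).prod :=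
  TensorAlgebra.tprod_apply _ _ _

theorem map_mono {A : Type*} [Semiring A] [Algebra F A] (φ : Tens F H X →ₐ[F] A)
    (w : Fin n → X) (h : Fin n → H) :
    φ (mono w h) = (List.ofFn fun i => φ (gen F H (w i) (h i))).prod := by
  rw [mono_eq_prod, map_list_prod, List.map_ofFn]
  rfl

theorem renameVars_mono (e : X → Y) (w : Fin n → X) (h : Fin n → H) :
    renameVars e (mono (F := F) w h) = mono (fun i => e (w i)) h := by
  rw [map_mono, mono_eq_prod]
  simp only [renameVars_gen]

theorem mono_mem (hn : n ≠ 0) (w : Fin n → X) (h : Fin n → H) :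
    mono w h ∈ hpolySubalgebra F H X := by
  obtain ⟨n, rfl⟩ := Nat.exists_eq_succ_of_ne_zero hn
  rw [mono_eq_prod]
  induction n with
  | zero => simpa using gen_mem _ _
  | succ n ih =>
    rw [List.ofFn_succ, List.prod_cons]
    exact mul_mem (gen_mem _ _) (ih (by simp) (fun i => w i.succ) fun i => h i.succ)

variable [DecidableEq X]

/-- The sum of the new variables in `S` which replace `x`. -/
def polarVar (p : Fin n → X) (S : Finset (Fin n)) (x : X) : HPoly F H (Fin n) :=
  ∑ a ∈ S with p a = x, var a

/-- The full linearization of the part of degree `n`, in which the variable `x` is replaced by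
the variables `a` with `p a = x`. -/
def linearize (p : Fin n → X) : Tens F H X →ₗ[F] Tens F H (Fin n) :=
  ∑ S : Finset (Fin n), (-1 : F) ^ #Sᶜ • (subst (polarVar p S)).toLinearMap

theorem linearize_apply (p : Fin n → X) (f : Tens F H X) :
    linearize p f = ∑ S : Finset (Fin n), (-1 : F) ^ #Sᶜ • subst (polarVar p S) f := by
  simp [linearize]

theorem subst_polarVar_mono (p : Fin n → X) (S : Finset (Fin n)) (w : Fin n → X)
    (h : Fin n → H) : subst (polarVar p S) (mono (F := F) w h) =
      ∑ r : Fin n → Fin n, if (∀ i, p (r i) = w i) ∧ ∀ i, r i ∈ S then mono r h else 0 := by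
  have h1 : ∀ x k, subst (polarVar p S) (gen F H x k) =
      TensorAlgebra.ι F (∑ a ∈ S with p a = x, Finsupp.single a k) := by
    intro x k
    rw [subst_gen, polarVar, map_sum]
    have : ∀ (s : Finset (Fin n)), act k (((∑ a ∈ s, var a : HPoly F H (Fin n))) :
        Tens F H (Fin n)) = ∑ a ∈ s, gen F H a k := by
      intro s
      induction s using Finset.induction_on with
      | empty => exact act_zero k
      | insert a s ha ih =>
        rw [sum_insert ha, sum_insert ha, NonUnitalSubalgebra.coe_add, act_add, ih, var, act_gen,
          mul_one]
    exact this _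
  rw [map_mono]
  simp only [h1]
  rw [← TensorAlgebra.tprod_apply, MultilinearMap.map_sum_finset, ← sum_filter]
  refine sum_congr ?_ fun r _ => rfl
  ext r
  simp only [Fintype.mem_piFinset, mem_filter, mem_univ, true_and]
  exact ⟨fun h => ⟨fun i => (h i).2, fun i => (h i).1⟩, fun h i => ⟨h.2 i, h.1 i⟩⟩

theorem linearize_mono (p : Fin n → X) (w : Fin n → X) (h : Fin n → H) :
    linearize p (mono (F := F) w h) =
      ∑ τ : Equiv.Perm (Fin n) with ∀ i, p (τ i) = w i, mono τ h := by
  rw [linearize_apply]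
  simp only [subst_polarVar_mono, smul_sum]
  rw [sum_comm]
  have h1 : ∀ r : Fin n → Fin n, ∑ S : Finset (Fin n), (-1 : F) ^ #Sᶜ •
      (if (∀ i, p (r i) = w i) ∧ ∀ i, r i ∈ S then mono (F := F) r h else 0) =
      if (∀ i, p (r i) = w i) ∧ Function.Bijective r then mono r h else 0 := by
    intro r
    by_cases hr : ∀ i, p (r i) = w i
    · have := congrArg (fun x : F => x • mono (F := F) r h) (sum_neg_one_pow_card_compl r)
      simp only [sum_smul, ite_smul, zero_smul, one_smul] at this
      simp only [hr, true_and, smul_ite, smul_zero, implies_true]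
      exact this
    · simp [hr]
  rw [sum_congr rfl fun r _ => h1 r, ← sum_filter]
  refine (Finset.sum_bij (fun (τ : Equiv.Perm (Fin n)) _ => (τ : Fin n → Fin n)) ?_ ?_ ?_ ?_).symm
  · intro τ hτ
    exact mem_filter.2 ⟨mem_univ _, (mem_filter.1 hτ).2, τ.bijective⟩
  · intro τ _ σ _ h
    exact Equiv.coe_fn_injective h
  · intro r hr
    have hr := (mem_filter.1 hr).2
    exact ⟨Equiv.ofBijective r hr.2, by simpa using hr.1, rfl⟩
  · intro τ _
    rfl

/-- The multilinear polynomials in the variables indexed by `Fin n`. -/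
def multilinearSubspace (F H : Type*) [Field F] [Ring H] [HopfAlgebra F H] (n : ℕ) :
    Submodule F (Tens F H (Fin n)) :=
  Submodule.span F {q | ∃ (τ : Equiv.Perm (Fin n)) (h : Fin n → H), q = mono τ h}

theorem renameVars_mem_multilinearSubspace (σ : Equiv.Perm (Fin n)) {q : Tens F H (Fin n)}
    (hq : q ∈ multilinearSubspace F H n) : renameVars σ q ∈ multilinearSubspace F H n := by
  induction hq using Submodule.span_induction with
  | mem q hq =>
    obtain ⟨τ, h, rfl⟩ := hq
    rw [renameVars_mono]
    exact Submodule.subset_span ⟨σ * τ, h, rfl⟩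
  | zero => rw [map_zero]; exact zero_mem _
  | add p q _ _ hp hq => rw [map_add]; exact add_mem hp hq
  | smul c p _ hp => rw [map_smul]; exact Submodule.smul_mem _ c hp

theorem linearize_renameVars (c : Fin n → X) {q : Tens F H (Fin n)}
    (hq : q ∈ multilinearSubspace F H n) : linearize c (renameVars c q) =
      ∑ σ : Equiv.Perm (Fin n) with ∀ i, c (σ i) = c i, renameVars σ q := by
  induction hq using Submodule.span_induction with
  | mem q hq =>
    obtain ⟨τ, h, rfl⟩ := hq
    rw [renameVars_mono, linearize_mono]
    simp only [renameVars_mono]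
    refine Finset.sum_nbij' (fun σ => σ * τ⁻¹) (fun σ => σ * τ) ?_ ?_ ?_ ?_ ?_
    · intro σ hσ
      simp only [mem_filter, mem_univ, true_and] at hσ ⊢
      intro i
      rw [Equiv.Perm.mul_apply, hσ]
      exact congrArg c (τ.apply_symm_apply i)
    · intro σ hσ
      simp only [mem_filter, mem_univ, true_and] at hσ ⊢
      intro i
      exact hσ (τ i)
    · simp
    · simp
    · intro σ _
      simp
  | zero => simp
  | add p q _ _ hp hq => simp only [map_add, hp, hq, sum_add_distrib]
  | smul c p _ hp => simp only [map_smul, hp, smul_sum]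

/-- The homogeneous polynomials of degree `n` in the variables from `V`. -/
def homogeneousSubspace (F H : Type*) [Field F] [Ring H] [HopfAlgebra F H] (V : Finset X)
    (n : ℕ) : Submodule F (Tens F H X) :=
  Submodule.span F {q | ∃ (w : Fin n → X) (h : Fin n → H), (∀ i, w i ∈ V) ∧ q = mono w h}

theorem linearize_mem_multilinearSubspace (p : Fin n → X) {V : Finset X} {g : Tens F H X}
    (hg : g ∈ homogeneousSubspace F H V n) : linearize p g ∈ multilinearSubspace F H n := by
  induction hg using Submodule.span_induction with
  | mem q hq =>
    obtain ⟨w, h, -, rfl⟩ := hq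
    rw [linearize_mono]
    exact sum_mem fun τ _ => Submodule.subset_span ⟨τ, h, rfl⟩
  | zero => rw [map_zero]; exact zero_mem _
  | add p q _ _ hp hq => rw [map_add]; exact add_mem hp hq
  | smul c p _ hp => rw [map_smul]; exact Submodule.smul_mem _ c hp

/-- A homogeneous polynomial is recovered from its linearizations. -/
theorem sum_renameVars_linearize {V : Finset X} {g : Tens F H X}
    (hg : g ∈ homogeneousSubspace F H V n) :
    ∑ p ∈ Fintype.piFinset fun _ : Fin n => V, renameVars p (linearize p g) =
      (n.factorial : F) • g := by
  induction hg using Submodule.span_induction with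
  | mem q hq =>
    obtain ⟨w, h, hw, rfl⟩ := hq
    simp only [linearize_mono, map_sum, renameVars_mono]
    simp only [sum_filter]
    rw [sum_comm]
    have h1 : ∀ τ : Equiv.Perm (Fin n), ∑ p ∈ Fintype.piFinset fun _ : Fin n => V,
        (if ∀ i, p (τ i) = w i then mono (F := F) (fun i => p (τ i)) h else 0) = mono w h := by
      intro τ
      rw [sum_eq_single (fun i => w (τ.symm i))]
      · simp
      · intro p _ hp
        rw [if_neg]
        intro hτ
        refine hp (funext fun i => ?_)
        simpa using hτ (τ.symm i)
      · intro h
        exact absurd (Fintype.mem_piFinset.2 fun i => hw _) h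
    rw [sum_congr rfl fun τ _ => h1 τ, sum_const, card_univ, Fintype.card_perm, Fintype.card_fin,
      Nat.cast_smul_eq_nsmul]
  | zero => simp
  | add p q _ _ hp hq => simp only [map_add, sum_add_distrib, hp, hq, smul_add]
  | smul c p _ hp =>
    simp only [map_smul, ← smul_sum, hp]
    rw [smul_comm]

theorem homogeneousSubspace_mono {V V' : Finset X} (h : V ⊆ V') (n : ℕ) :
    homogeneousSubspace F H V n ≤ homogeneousSubspace F H V' n := by
  refine Submodule.span_mono ?_
  rintro _ ⟨w, k, hw, rfl⟩
  exact ⟨w, k, fun i => h (hw i), rfl⟩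

theorem homogeneousSubspace_le (hn : n ≠ 0) (V : Finset X) {g : Tens F H X}
    (hg : g ∈ homogeneousSubspace F H V n) : g ∈ hpolySubalgebra F H X := by
  induction hg using Submodule.span_induction with
  | mem q hq =>
    obtain ⟨w, h, -, rfl⟩ := hq
    exact mono_mem hn w h
  | zero => exact zero_mem _
  | add p q _ _ hp hq => exact add_mem hp hq
  | smul c p _ hp => exact SMulMemClass.smul_mem c hp

theorem mul_mem_homogeneousSubspace {V : Finset X} {m : ℕ} {p q : Tens F H X}
    (hp : p ∈ homogeneousSubspace F H V m) (hq : q ∈ homogeneousSubspace F H V n) :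
    p * q ∈ homogeneousSubspace F H V (m + n) := by
  refine Submodule.mul_le.1 (?_ : homogeneousSubspace F H V m * homogeneousSubspace F H V n ≤ _)
    p hp q hq
  rw [homogeneousSubspace, homogeneousSubspace, Submodule.span_mul_span]
  refine Submodule.span_mono ?_
  rintro _ ⟨_, ⟨w, h, hw, rfl⟩, _, ⟨w', h', hw', rfl⟩, rfl⟩
  refine ⟨Fin.append w w', Fin.append h h', fun i => ?_, ?_⟩
  · refine Fin.addCases (fun i => ?_) (fun i => ?_) i
    · simpa using hw i
    · simpa using hw' i
  · simp only [mono_eq_prod]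
    rw [← List.prod_append, ← List.ofFn_fin_append]
    congr 2
    funext i
    refine Fin.addCases (fun i => ?_) (fun i => ?_) i <;> simp

/-- Every polynomial without constant term is a sum of homogeneous polynomials of positive
degrees. -/
theorem exists_homogeneous_decomposition {f : Tens F H X} (hf : f ∈ hpolySubalgebra F H X) :
    ∃ (V : Finset X) (D : Finset ℕ) (g : ℕ → Tens F H X), 0 ∉ D ∧
      (∀ n, g n ∈ homogeneousSubspace F H V n) ∧ f = ∑ n ∈ D, g n := by
  suffices h : ∃ V : Finset X, f ∈ ⨆ n : {n : ℕ // n ≠ 0}, homogeneousSubspace F H V n by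
    obtain ⟨V, hV⟩ := h
    obtain ⟨g, hg, rfl⟩ := (Submodule.mem_iSup_iff_exists_finsupp _ _).1 hV
    refine ⟨V, g.support.map ⟨Subtype.val, Subtype.val_injective⟩,
      fun n => if hn : n ≠ 0 then g ⟨n, hn⟩ else 0, ?_, fun n => ?_, ?_⟩
    · simp
    · dsimp only
      split_ifs with hn
      · exact hg ⟨n, hn⟩
      · exact zero_mem _
    · rw [sum_map, Finsupp.sum]
      refine sum_congr rfl fun n _ => ?_
      simp [n.2]
  have hmono : ∀ {V V' : Finset X}, V ⊆ V' →
      (⨆ n : {n : ℕ // n ≠ 0}, homogeneousSubspace F H V n) ≤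
        ⨆ n : {n : ℕ // n ≠ 0}, homogeneousSubspace F H V' n := fun h =>
    iSup_mono fun n => homogeneousSubspace_mono h n
  induction hf using hpoly_induction with
  | hgen x h =>
    refine ⟨{x}, Submodule.mem_iSup_of_mem ⟨1, one_ne_zero⟩ (Submodule.subset_span
      ⟨fun _ => x, fun _ => h, by simp, ?_⟩)⟩
    simp [mono_eq_prod]
  | hzero => exact ⟨∅, zero_mem _⟩
  | hadd p q _ _ hp hq =>
    obtain ⟨V, hp⟩ := hp
    obtain ⟨V', hq⟩ := hq
    exact ⟨V ∪ V', add_mem (hmono subset_union_left hp) (hmono subset_union_right hq)⟩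
  | hmul p q _ _ hp hq =>
    obtain ⟨V, hp⟩ := hp
    obtain ⟨V', hq⟩ := hq
    refine ⟨V ∪ V', ?_⟩
    have h := Submodule.mul_mem_mul (hmono (subset_union_left (s₂ := V')) hp)
      (hmono (subset_union_right (s₁ := V)) hq)
    rw [Submodule.iSup_mul] at h
    refine SetLike.le_def.1 (iSup_le fun m => ?_) h
    rw [Submodule.mul_iSup]
    refine iSup_le fun n => Submodule.mul_le.2 fun a ha b hb => ?_
    exact Submodule.mem_iSup_of_mem ⟨m + n, by have := m.2; omega⟩
      (mul_mem_homogeneousSubspace ha hb)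
  | hsmul c p _ hp =>
    obtain ⟨V, hp⟩ := hp
    exact ⟨V, Submodule.smul_mem _ c hp⟩

theorem subst_smul_homogeneous (s : X → HPoly F H Y) (c : F) {V : Finset X} {g : Tens F H X}
    (hg : g ∈ homogeneousSubspace F H V n) :
    subst (fun x => c • s x) g = c ^ n • subst s g := by
  induction hg using Submodule.span_induction with
  | mem q hq =>
    obtain ⟨w, h, -, rfl⟩ := hq
    have h1 : ∀ x k, subst (fun x => c • s x) (gen F H x k) = c • subst s (gen F H x k) :=
      fun x k => by rw [subst_gen, subst_gen, ← act_smul]; rfl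
    rw [map_mono, map_mono]
    simp only [h1]
    exact ((MultilinearMap.mkPiAlgebraFin F n (Tens F H Y)).map_smul_univ (fun _ => c) _).trans
      (by simp)
  | zero => simp
  | add p q _ _ hp hq => simp only [map_add, hp, hq, smul_add]
  | smul c p _ hp => simp only [map_smul, hp]; rw [smul_comm]

end Linearization

/-- Over an infinite field, a subspace contains the coefficients of every polynomial with values
in it. -/
theorem coeff_mem_of_forall_sum_pow_smul_mem {F M : Type*} [Field F] [Infinite F]
    [AddCommGroup M] [Module F M] (I : Submodule F M) (D : Finset ℕ) (v : ℕ → M)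
    (h : ∀ c : F, ∑ n ∈ D, c ^ n • v n ∈ I) {n : ℕ} (hn : n ∈ D) : v n ∈ I := by
  rw [← Submodule.Quotient.mk_eq_zero, ← Module.forall_dual_apply_eq_zero_iff F]
  intro φ
  set P : Polynomial F := ∑ n ∈ D, Polynomial.monomial n (φ (I.mkQ (v n))) with hP
  have hP0 : P = 0 := by
    refine Polynomial.funext fun c => ?_
    have h1 := congrArg φ ((Submodule.Quotient.mk_eq_zero I).2 (h c))
    rw [← Submodule.mkQ_apply, map_sum, map_sum, map_zero] at h1
    rw [hP, Polynomial.eval_finsetSum, Polynomial.eval_zero, ← h1]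
    refine Finset.sum_congr rfl fun n _ => ?_
    rw [Polynomial.eval_monomial, map_smul, map_smul, smul_eq_mul, mul_comm]
  have h2 := congrArg (fun p : Polynomial F => p.coeff n) hP0
  simpa [hP, Polynomial.finsetSum_coeff, Polynomial.coeff_monomial, hn] using h2

section Action

open Finset

variable (F H : Type*) [Field F] [Ring H] [HopfAlgebra F H] (n : ℕ)

/-- The action of the group algebra of the symmetric group by renaming of variables. -/
def permAction :
    MonoidAlgebra F (Equiv.Perm (Fin n)) →ₐ[F] Module.End F (Tens F H (Fin n)) :=
  MonoidAlgebra.lift F _ _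
    { toFun := fun σ => (renameVars σ).toLinearMap
      map_one' := LinearMap.ext renameVars_id
      map_mul' := fun σ τ => LinearMap.ext fun q => (renameVars_renameVars σ τ q).symm }

variable {F H n}

theorem permAction_perm (σ : Equiv.Perm (Fin n)) (q : Tens F H (Fin n)) :
    permAction F H n (perm F σ) q = renameVars σ q := by
  simp [permAction, perm]

theorem permAction_induction {P : Submodule F (Tens F H (Fin n))}
    (hP : ∀ (σ : Equiv.Perm (Fin n)), ∀ q ∈ P, renameVars σ q ∈ P)
    (a : MonoidAlgebra F (Equiv.Perm (Fin n))) {q : Tens F H (Fin n)} (hq : q ∈ P) :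
    permAction F H n a q ∈ P := by
  induction a using MonoidAlgebra.induction_on with
  | of σ => rw [← perm, permAction_perm]; exact hP σ q hq
  | add a b ha hb => rw [map_add]; exact add_mem ha hb
  | smul c a ha => rw [map_smul]; exact Submodule.smul_mem _ c ha

theorem permAction_symmetrizer {X : Type*} [DecidableEq X] (c : Fin n → X)
    {q : Tens F H (Fin n)} (hq : q ∈ multilinearSubspace F H n) :
    permAction F H n (symmetrizer F c) q = linearize c (renameVars c q) := by
  rw [linearize_renameVars c hq, symmetrizer, map_sum, LinearMap.sum_apply]
  exact sum_congr (by ext; simp) fun σ _ => permAction_perm σ q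

end Action

section Main

open Finset

variable {F H : Type*} [Field F] [Ring H] [HopfAlgebra F H] {X Y : Type*} {n : ℕ}
variable {W : Type*} [NonUnitalRing W] [Module F W] [IsScalarTower F W W] [SMulCommClass F W W]
  [Module H W] [IsScalarTower F H W] [HModuleAlgebra F H W]

theorem linearize_mem_idSubspace [DecidableEq X] (p : Fin n → X) {f : Tens F H X}
    (hf : f ∈ idSubspace F H X W) : linearize p f ∈ idSubspace F H (Fin n) W := by
  rw [linearize_apply]
  exact sum_mem fun S _ => Submodule.smul_mem _ _ (subst_mem_idSubspace _ hf)

theorem multilinearSubspace_le (hn : n ≠ 0) {q : Tens F H (Fin n)}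
    (hq : q ∈ multilinearSubspace F H n) : q ∈ hpolySubalgebra F H (Fin n) := by
  refine homogeneousSubspace_le hn univ (Submodule.span_mono ?_ hq)
  rintro _ ⟨τ, h, rfl⟩
  exact ⟨τ, h, by simp, rfl⟩

theorem isMultilinear_renameVars {q : Tens F H (Fin n)} (hq : q ∈ multilinearSubspace F H n)
    (hq' : renameVars Fin.val q ∈ hpolySubalgebra F H ℕ) :
    IsMultilinear ((univ : Finset (Fin n)).map Fin.valEmbedding)
      (⟨renameVars Fin.val q, hq'⟩ : HPoly F H ℕ) := by
  rw [IsMultilinear]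
  dsimp only
  clear hq'
  induction hq using Submodule.span_induction with
  | mem q hq =>
    obtain ⟨τ, h, rfl⟩ := hq
    refine Submodule.subset_span ⟨List.ofFn fun i => ((τ i : ℕ), h i), ?_, ?_⟩
    · conv_rhs => rw [map_val, ← Multiset.map_univ_val_equiv τ, Multiset.map_map]
      rw [List.map_ofFn, ← Fin.univ_val_map]
      rfl
    · rw [renameVars_mono, mono_eq_prod, List.map_ofFn]
      rfl
  | zero => rw [map_zero]; exact zero_mem _
  | add p q _ _ hp hq => rw [map_add]; exact add_mem hp hq
  | smul c p _ hp => rw [map_smul]; exact Submodule.smul_mem _ c hp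

theorem permAction_antisymmetrizer_mem {t : ℕ} (hW : SatisfiesCapelli F H W t) (hn : n ≠ 0)
    {S : Finset (Fin n)} (hS : t ≤ #S) {q : Tens F H (Fin n)}
    (hq : q ∈ multilinearSubspace F H n) :
    permAction F H n (antisymmetrizer F S) q ∈ idSubspace F H (Fin n) W := by
  set r := permAction F H n (antisymmetrizer F S) q with hr
  have hr1 : r ∈ multilinearSubspace F H n :=
    permAction_induction (fun σ q hq => renameVars_mem_multilinearSubspace σ hq) _ hq
  have hr2 : renameVars Fin.val r ∈ hpolySubalgebra F H ℕ := by
    rw [renameVars_eq_subst]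
    exact subst_mem _ (multilinearSubspace_le hn hr1)
  have h1 : renameVars Fin.val r ∈ idSubspace F H ℕ W := by
    refine ⟨hr2, hW _ (S.map Fin.valEmbedding) _ (map_subset_map.2 (subset_univ S)) ?_
      (isMultilinear_renameVars hr1 hr2) ?_⟩
    · rwa [card_map]
    · intro x hx y hy hxy
      obtain ⟨x, hxS, rfl⟩ := mem_map.1 hx
      obtain ⟨y, hyS, rfl⟩ := mem_map.1 hy
      have hxy : x ≠ y := fun e => hxy (e ▸ rfl)
      have hswap : renameVars (Equiv.swap x y) r = -r := by
        rw [← permAction_perm, hr, ← Module.End.mul_apply, ← map_mul,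
          perm_mul_antisymmetrizer fun i hi => Equiv.swap_apply_of_ne_of_ne
            (fun e => hi (e ▸ hxS)) fun e => hi (e ▸ hyS), Equiv.Perm.sign_swap hxy]
        simp
      change renameVars (Equiv.swap (x : ℕ) (y : ℕ)) (renameVars Fin.val r) = -renameVars Fin.val r
      rw [renameVars_renameVars, Fin.val_injective.swap_comp, ← renameVars_renameVars, hswap,
        map_neg]
  have : Nonempty (Fin n) := ⟨⟨0, Nat.pos_of_ne_zero hn⟩⟩
  have h2 := renameVars_mem_idSubspace (Function.invFun (Fin.val : Fin n → ℕ)) h1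
  rwa [renameVars_renameVars, Function.invFun_comp Fin.val_injective, renameVars_id] at h2

variable [CharZero F]

/-- A multilinear polynomial is an identity if it becomes one after every identification of its
variables with fewer than `t` variables. -/
theorem multilinear_mem_idSubspace {t : ℕ} (ht : 1 ≤ t) (hW : SatisfiesCapelli F H W t)
    (hn : n ≠ 0) {q : Tens F H (Fin n)} (hq : q ∈ multilinearSubspace F H n)
    (h : ∀ c : Fin n → Fin (t - 1), renameVars c q ∈ idSubspace F H (Fin (t - 1)) W) :
    q ∈ idSubspace F H (Fin n) W := by
  let L : Submodule (MonoidAlgebra F (Equiv.Perm (Fin n)))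
      (MonoidAlgebra F (Equiv.Perm (Fin n))) :=
    { carrier := {a | permAction F H n a q ∈ idSubspace F H (Fin n) W}
      add_mem' := fun {a b} ha hb => by
        change permAction F H n (a + b) q ∈ idSubspace F H (Fin n) W
        rw [map_add]
        exact add_mem ha hb
      zero_mem' := by
        change permAction F H n 0 q ∈ idSubspace F H (Fin n) W
        rw [map_zero]
        exact zero_mem _
      smul_mem' := fun a b hb => by
        change permAction F H n (a * b) q ∈ idSubspace F H (Fin n) W
        rw [map_mul]
        exact permAction_induction (fun σ q hq => renameVars_mem_idSubspace σ hq) a hb }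
  have hL : (1 : MonoidAlgebra F (Equiv.Perm (Fin n))) ∈ L := by
    refine one_mem_of_symmetrizer_mem ht L (fun S hS a => ?_) fun c => ?_
    · change permAction F H n (antisymmetrizer F S * a) q ∈ idSubspace F H (Fin n) W
      rw [map_mul]
      exact permAction_antisymmetrizer_mem hW hn hS
        (permAction_induction (fun σ q hq => renameVars_mem_multilinearSubspace σ hq) a hq)
    · change permAction F H n (symmetrizer F c) q ∈ idSubspace F H (Fin n) W
      rw [permAction_symmetrizer c hq]
      exact linearize_mem_idSubspace c (h c)
  have h1 : permAction F H n 1 q ∈ idSubspace F H (Fin n) W := hL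
  rwa [map_one] at h1

theorem subst_subst {Z : Type*} (s : Y → HPoly F H Z) (s' : X → HPoly F H Y) (f : Tens F H X) :
    subst s (subst s' f) = subst (fun x => substHom s (s' x)) f := by
  have : (subst s).comp (subst s') = subst fun x => substHom s (s' x) :=
    tens_ext fun x k => by
      rw [AlgHom.comp_apply, subst_gen, subst_gen, subst_act s k (s' x).2]
      rfl
  exact congrArg (fun φ => φ f) this

theorem homogeneous_mem_idSubspace [DecidableEq X] {t : ℕ} (ht : 1 ≤ t)
    (hW : SatisfiesCapelli F H W t) (hn : n ≠ 0) {V : Finset X} {g : Tens F H X}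
    (hg : g ∈ homogeneousSubspace F H V n)
    (h : ∀ s : X → HPoly F H (Fin (t - 1)), subst s g ∈ idSubspace F H (Fin (t - 1)) W) :
    g ∈ idSubspace F H X W := by
  have h1 : ∀ p : Fin n → X, linearize p g ∈ idSubspace F H (Fin n) W := fun p =>
    multilinear_mem_idSubspace ht hW hn (linearize_mem_multilinearSubspace p hg) fun c => by
      rw [linearize_apply, map_sum]
      refine sum_mem fun S _ => ?_
      rw [map_smul, renameVars_eq_subst, subst_subst]
      exact Submodule.smul_mem _ _ (h _)
  have h2 : (n.factorial : F) • g ∈ idSubspace F H X W := by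
    rw [← sum_renameVars_linearize hg]
    exact sum_mem fun p _ => renameVars_mem_idSubspace p (h1 p)
  exact (Submodule.smul_mem_iff _ (Nat.cast_ne_zero.2 n.factorial_ne_zero)).1 h2

theorem identities_relFree_le_identities {t : ℕ} (ht : 1 ≤ t) (hW : SatisfiesCapelli F H W t) :
    identities F H X (RelFree F H (Fin (t - 1)) W) ≤ identities F H X W := by
  classical
  intro f hf
  obtain ⟨V, D, g, hD, hg, hfg⟩ := exists_homogeneous_decomposition f.2
  rw [← mem_idSubspace, hfg]
  refine sum_mem fun n hn => homogeneous_mem_idSubspace ht hW (fun e => hD (e ▸ hn)) (hg n)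
    fun s => ?_
  refine coeff_mem_of_forall_sum_pow_smul_mem _ D (fun n => subst s (g n)) (fun c => ?_) hn
  have h := subst_mem_of_mem_identities_relFree hf fun x => c • s x
  rw [hfg, map_sum] at h
  simpa only [subst_smul_homogeneous s c (hg _)] using h

end Main

end HopfPI

end

theorem mainTheorem7 {F H W : Type*} [Field F] [CharZero F] [Ring H] [HopfAlgebra F H]
    [NonUnitalRing W] [Module F W] [IsScalarTower F W W] [SMulCommClass F W W]
    [Module H W] [IsScalarTower F H W] [HopfPI.HModuleAlgebra F H W]
    (t : ℕ) (ht : 1 ≤ t) (hW : HopfPI.SatisfiesCapelli F H W t) :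
    HopfPI.identities F H ℕ (HopfPI.RelFree F H (Fin (t - 1)) W) =
      HopfPI.identities F H ℕ W :=
  le_antisymm (HopfPI.identities_relFree_le_identities ht hW)
    HopfPI.identities_le_identities_relFree
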